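/- Let $Q$ be a smooth finite-dimensional manifold without boundary. A \emph{discretization map} on a manifold $M$ is a smooth map $R=(R^1,R^2)\colon U\subset TM\to M\times M$, where $U$ is an open neighbourhood of the zero section of $TM$, such that $R(x,0)=(x,x)$ and $T_{0_x}R^2_x-T_{0_x}R^1_x=\mathrm{Id}_{T_xM}$ for all $x\in M$, where $R^a_x$ is the restriction of $R^a$ to $T_xM$ and $T_{0_x}T_xM\simeq T_xM$. For any map $R\colon U\subset TM\to M\times M$, its \emph{adjoint} is the map $R^*(x,v)=I_M(R(x,-v))$ with $I_M(x,y)=(y,x)$, defined on $\{(x,v)\in TM : (x,-v)\in U\}$; $R$ is \emph{symmetric} if $R^*=R$ (equality of partially defined maps: same domain and same values). Let $R_d\colon U\subset TQ\to Q\times Q$ be a discretization map on $Q$. For $\beta\in T^*_wTQ$ with $w\in U$ and $T_wR_d$ invertible put $\widehat{R_d}(\beta)=\beta\circ(T_wR_d)^{-1}\in T^*_{R_d(w)}(Q\times Q)$. Let $\alpha_Q\colon TT^*Q\to T^*TQ$ be the canonical isomorphism, locally $(q,p,\dot q,\dot p)\mapsto(q,\dot q,\dot p,p)$, and let $\Phi\colon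 T^*Q\times T^*Q\to T^*(Q\times Q)$, $(q_0,p_0;q_1,p_1)\mapsto(q_0,q_1,-p_0,p_1)$. The \emph{cotangent lift} of $R_d$ is the map $$R_d^{T^*}=\Phi^{-1}\circ\widehat{R_d}\circ\alpha_Q\colon TT^*Q\to T^*Q\times T^*Q ,$$ defined at those $V\in TT^*Q$ for which $\alpha_Q(V)$ lies over a point $w\in U$ at which $T_wR_d$ is invertible. The cotangent lift of $R_d^*$ is defined in the same way. Then taking the cotangent lift commutes with taking the adjoint, $$(R_d^*)^{T^*}=(R_d^{T^*})^* ,$$ as an equality of partially defined maps $TT^*Q\to T^*Q\times T^*Q$. In particular, if $R_d$ is symmetric, then its cotangent lift $R_d^{T^*}$ is symmetric. -/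

import Mathlib

open scoped Manifold ContDiff

noncomputable section

namespace DiscretizationMaps

section Defs

variable {E : Type*} [NormedAddCommGroup E] [NormedSpace ℝ E]
  {H : Type*} [TopologicalSpace H] (I : ModelWithCorners ℝ E H)
  (M : Type*) [TopologicalSpace M] [ChartedSpace H M]

/-! ### Partial maps, discretization maps, adjoints -/

/-- A map `R : U ⊆ TM → M × M` defined on a subset `U = dom` of the tangent bundle. Only the values
of `toFun` on `dom` are meaningful. -/
structure PartialMap where
  dom : Set (TangentBundle I M)
  toFun : TangentBundle I M → M × M

variable {I M}

namespace PartialMap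

/-- Equality of partial maps: the same domain, and the same values on it. -/
def Same (R S : PartialMap I M) : Prop :=
  R.dom = S.dom ∧ Set.EqOn R.toFun S.toFun R.dom

end PartialMap

/-- The fibrewise reflection `(x, v) ↦ (x, -v)` of the tangent bundle. -/
def fiberNeg (w : TangentBundle I M) : TangentBundle I M := ⟨w.proj, -w.snd⟩

namespace PartialMap

/-- The adjoint `R^*(x, v) = I_M (R (x, -v))` with `I_M (x, y) = (y, x)`, defined on
`{(x, v) | (x, -v) ∈ U}`. -/
def adjoint (R : PartialMap I M) : PartialMap I M where
  dom := {w | fiberNeg w ∈ R.dom}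
  toFun w := (R.toFun (fiberNeg w)).swap

/-- `R` is symmetric if it is equal to its adjoint. -/
def IsSymmetric (R : PartialMap I M) : Prop := R.adjoint.Same R

/-- `R = (R¹, R²) : U ⊆ TM → M × M` is a discretization map on `M`. -/
structure IsDiscretizationMap [IsManifold I ∞ M] (R : PartialMap I M) : Prop where
  /-- The domain is an open neighbourhood of the zero section. -/
  isOpen_dom : IsOpen R.dom
  zero_mem_dom : ∀ x : M, (⟨x, 0⟩ : TangentBundle I M) ∈ R.dom
  /-- The map is smooth. -/
  smooth : ContMDiffOn I.tangent (I.prod I) ∞ R.toFun R.dom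
  /-- `R (x, 0) = (x, x)`. -/
  map_zero : ∀ x : M, R.toFun ⟨x, 0⟩ = (x, x)
  /-- `T_{0_x} R²_x - T_{0_x} R¹_x = Id` on `T_x M`, where `R^a_x = R^a|_{T_x M}`. Both derivatives
  take values in `T_x M` by the preceding condition; all these tangent spaces are the model space
  `E` (by means of the preferred chart at `x`). -/
  deriv_zero : ∀ x : M,
    let D₁ : E →L[ℝ] E := mfderiv 𝓘(ℝ, E) I (fun u : E => (R.toFun ⟨x, u⟩).1) 0
    let D₂ : E →L[ℝ] E := mfderiv 𝓘(ℝ, E) I (fun u : E => (R.toFun ⟨x, u⟩).2) 0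
    D₂ - D₁ = ContinuousLinearMap.id ℝ E

end PartialMap

/-! ### The cotangent bundle -/

variable (I) in
/-- The cotangent space `T_x^* M`, the dual of the tangent space. -/
abbrev CotangentSpace (x : M) : Type _ := TangentSpace I x →L[ℝ] Bundle.Trivial M ℝ x

variable (I M) in
/-- The cotangent bundle `T^*M`. It is a vector bundle over `M` with fibre `E →L[ℝ] ℝ`, and its
total space is a manifold modelled on `E × (E →L[ℝ] ℝ)`, by Mathlib's instances for bundles of
continuous linear maps. -/
abbrev CotangentBundle : Type _ :=
  Bundle.TotalSpace (E →L[ℝ] ℝ) (fun x : M => CotangentSpace I x)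

variable (I) in
/-- The model with corners of the manifold `T^*M`. -/
abbrev cotangentModel : ModelWithCorners ℝ (E × (E →L[ℝ] ℝ)) (ModelProd H (E →L[ℝ] ℝ)) :=
  I.prod 𝓘(ℝ, E →L[ℝ] ℝ)

variable {E' : Type*} [NormedAddCommGroup E'] [NormedSpace ℝ E']
  {H' : Type*} [TopologicalSpace H'] {I' : ModelWithCorners ℝ E' H'}
  {M' : Type*} [TopologicalSpace M'] [ChartedSpace H' M']

variable (I I') in
/-- The cotangent lift `F̂ = T^* F⁻¹ : T^*M → T^*M'`, `F̂ (β_x) = β_x ∘ (T_x F)⁻¹ ∈ T^*_{F x} M'`.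
It is meaningful at the points `x` at which `F` is a local diffeomorphism, that is, at which
`T_x F` is invertible; there `(T_x F)⁻¹` is the tangent map at `F x` of a local inverse of `F`. -/
def hatLift (F : M → M') (β : CotangentBundle I M) : CotangentBundle I' M' :=
  ⟨F β.proj, ContinuousLinearMap.comp (β.snd : TangentSpace I β.proj →L[ℝ] ℝ)
    (mfderiv I I' F β.proj).inverse⟩

variable (I M) in
/-- The diffeomorphism `Φ : T^*M × T^*M → T^*(M × M)`, `(q₀, p₀; q₁, p₁) ↦ (q₀, q₁, -p₀, p₁)`. -/
def Phi : CotangentBundle I M × CotangentBundle I M ≃ CotangentBundle (I.prod I) (M × M) where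
  toFun a := ⟨(a.1.proj, a.2.proj),
    ContinuousLinearMap.coprod (M₁ := TangentSpace I a.1.proj) (M₂ := TangentSpace I a.2.proj)
      (-(a.1.snd : TangentSpace I a.1.proj →L[ℝ] ℝ))
      (a.2.snd : TangentSpace I a.2.proj →L[ℝ] ℝ)⟩
  invFun b :=
    (⟨b.proj.1, -(ContinuousLinearMap.comp (b.snd : E × E →L[ℝ] ℝ)
        (ContinuousLinearMap.inl ℝ E E))⟩,
      ⟨b.proj.2, ContinuousLinearMap.comp (b.snd : E × E →L[ℝ] ℝ)
        (ContinuousLinearMap.inr ℝ E E)⟩)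
  left_inv a := by
    obtain ⟨⟨x, p⟩, ⟨y, r⟩⟩ := a
    have h1 : ∀ p r : E →L[ℝ] ℝ,
        -((ContinuousLinearMap.coprod (-p) r).comp (ContinuousLinearMap.inl ℝ E E)) = p := by
      intro p r; ext u; simp
    have h2 : ∀ p r : E →L[ℝ] ℝ,
        (ContinuousLinearMap.coprod (-p) r).comp (ContinuousLinearMap.inr ℝ E E) = r := by
      intro p r; ext u; simp
    exact Prod.ext (congrArg (Bundle.TotalSpace.mk x) (h1 p r))
      (congrArg (Bundle.TotalSpace.mk y) (h2 p r))
  right_inv b := by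
    obtain ⟨⟨x, y⟩, β⟩ := b
    have h : ∀ β : E × E →L[ℝ] ℝ,
        ContinuousLinearMap.coprod (-(-(β.comp (ContinuousLinearMap.inl ℝ E E))))
          (β.comp (ContinuousLinearMap.inr ℝ E E)) = β := by
      intro β; ext u <;> simp
    exact congrArg (Bundle.TotalSpace.mk (x, y)) (h β)

/-! ### The canonical isomorphism `α_M : TT^*M → T^*TM` -/

open Bundle in
/-- The velocity at `0` of a curve in the total space of a bundle `Z` over `M`: its components are
the derivatives of the two components of the curve in the preferred chart at its starting point. -/
lemma hasDerivAt_total {F : Type*} [NormedAddCommGroup F] [NormedSpace ℝ F] {Z : M → Type*}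
    [TopologicalSpace (Bundle.TotalSpace F Z)] [∀ x, TopologicalSpace (Z x)] [FiberBundle F Z]
    (f : ℝ → Bundle.TotalSpace F Z) (hf : MDifferentiableAt 𝓘(ℝ, ℝ) (I.prod 𝓘(ℝ, F)) f 0) :
    HasDerivAt (fun t => extChartAt I (f 0).proj (f t).proj)
      (mfderiv 𝓘(ℝ, ℝ) (I.prod 𝓘(ℝ, F)) f 0 (1 : ℝ) : E × F).1 0 ∧
    HasDerivAt (fun t => (trivializationAt F Z (f 0).proj (f t)).2)
      (mfderiv 𝓘(ℝ, ℝ) (I.prod 𝓘(ℝ, F)) f 0 (1 : ℝ) : E × F).2 0 := by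
  have h := hf.hasMFDerivAt.2
  simp only [writtenInExtChartAt, modelWithCornersSelf_coe, Set.range_id,
    extChartAt_model_space_eq_id] at h
  rw [FiberBundle.extChartAt] at h
  have h2 : HasFDerivAt (fun t : ℝ => ((extChartAt I (f 0).proj (f t).proj, (trivializationAt F Z (f 0).proj (f t)).2) : E × F))
    (mfderiv 𝓘(ℝ, ℝ) (I.prod 𝓘(ℝ, F)) f 0 : ℝ →L[ℝ] E × F) (0:ℝ) := by
    have h3 := (hasFDerivWithinAt_univ.1 h)
    refine h3.congr_of_eventuallyEq ?_
    have : ∀ᶠ t in nhds (0:ℝ), f t ∈ (trivializationAt F Z (f 0).proj).source :=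
      hf.continuousAt.eventually ((trivializationAt F Z (f 0).proj).open_source.mem_nhds (by simp))
    filter_upwards [this] with t ht
    simp [Trivialization.coe_fst _ ht]
  exact ⟨h2.fst.hasDerivAt, h2.snd.hasDerivAt⟩

variable [IsManifold I ∞ M]

/-- The canonical (Tulczyjew) isomorphism `α_M : TT^*M → T^*TM`, given in the coordinates induced
by a chart of `M` by `(q, p, q̇, ṗ) ↦ (q, q̇, ṗ, p)`. For `q = π (V)`, the tangent spaces
`T_{(q, p)} T^*M = E × (E →L[ℝ] ℝ)` and `T_{(q, q̇)} TM = E × E` are by construction the spaces of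
vectors in the coordinates induced by the preferred chart of `M` at `q`. -/
def tulczyjew (V : TangentBundle (cotangentModel I) (CotangentBundle I M)) :
    CotangentBundle I.tangent (TangentBundle I M) :=
  let p : E →L[ℝ] ℝ := V.proj.snd
  let V' : E × (E →L[ℝ] ℝ) := V.snd
  ⟨⟨V.proj.proj, V'.1⟩, ContinuousLinearMap.coprod (M₁ := E) (M₂ := E) V'.2 p⟩

open Bundle in
/-- Validation of the definition of `tulczyjew`: it satisfies the intrinsic characterization of
`α_M`. If `σ = (c, p)` is a curve in `T^*M` and `γ = (c, v)` a curve in `TM` over the same base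
curve `c`, with velocities `σ'` and `γ'` at `0`, then `α_M (σ')` lies over `ċ(0)`, and
`⟨α_M (σ'), κ_M (γ')⟩ = d/dt ⟨p (t), v (t)⟩` at `t = 0`, where `κ_M (γ') = (v 0, γ'.2)` is the image
of `γ' = (ċ(0), γ'.2) ∈ T_{(c 0, v 0)} TM` under the canonical involution
`κ_M (q, v, q̇, v̇) = (q, q̇, v, v̇)`. In particular `tulczyjew` does not depend on charts. -/
theorem tulczyjew_pairing (c : ℝ → M) (p : ∀ t, CotangentSpace I (c t))
    (v : ∀ t, TangentSpace I (c t))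
    (hp : MDifferentiableAt 𝓘(ℝ, ℝ) (cotangentModel I)
      (fun t => (⟨c t, p t⟩ : CotangentBundle I M)) 0)
    (hv : MDifferentiableAt 𝓘(ℝ, ℝ) I.tangent
      (fun t => (⟨c t, v t⟩ : TangentBundle I M)) 0) :
    let σ' : E × (E →L[ℝ] ℝ) := mfderiv 𝓘(ℝ, ℝ) (cotangentModel I)
      (fun t => (⟨c t, p t⟩ : CotangentBundle I M)) 0 (1 : ℝ)
    let γ' : E × E := mfderiv 𝓘(ℝ, ℝ) I.tangent
      (fun t => (⟨c t, v t⟩ : TangentBundle I M)) 0 (1 : ℝ)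
    let α := tulczyjew (⟨⟨c 0, p 0⟩, σ'⟩ : TangentBundle (cotangentModel I) (CotangentBundle I M))
    α.proj = ⟨c 0, γ'.1⟩ ∧ HasDerivAt (fun t => (p t (v t) : ℝ)) (α.snd (v 0, γ'.2)) 0 := by
  intro σ' γ' α
  obtain ⟨h1, h2⟩ := hasDerivAt_total _ hp
  obtain ⟨h3, h4⟩ := hasDerivAt_total _ hv
  refine ⟨?_, ?_⟩
  · exact congrArg (TotalSpace.mk (c 0)) (h1.unique h3)
  · have h5 := h2.clm_apply h4
    have key : ∀ᶠ t in nhds (0:ℝ), c t ∈ (chartAt H (c 0)).source := by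
      have : ContinuousAt c 0 := by
        have := (FiberBundle.continuous_proj E (TangentSpace I : M → Type _)).continuousAt.comp hv.continuousAt
        exact this
      exact this.eventually ((chartAt H (c 0)).open_source.mem_nhds (mem_chart_source H _))
    have hval : ∀ t, c t ∈ (chartAt H (c 0)).source → (trivializationAt (E →L[ℝ] ℝ) (fun x : M => CotangentSpace I x) (c 0) (⟨c t, p t⟩ : CotangentBundle I M)).2 ((trivializationAt E (TangentSpace I : M → Type _) (c 0) (⟨c t, v t⟩ : TangentBundle I M)).2) = p t (v t) := by
      intro t ht
      rw [hom_trivializationAt_apply]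
      rw [ContinuousLinearMap.inCoordinates_eq (by simpa using ht) (by simp)]
      have ht' : c t ∈ (trivializationAt E (TangentSpace I : M → Type _) (c 0)).baseSet := by simpa using ht
      change (p t) (((trivializationAt E (TangentSpace I : M → Type _) (c 0)).continuousLinearEquivAt ℝ (c t) ht').symm ((trivializationAt E (TangentSpace I : M → Type _) (c 0)).continuousLinearEquivAt ℝ (c t) ht' (v t))) = _
      rw [ContinuousLinearEquiv.symm_apply_apply]
    have z := hval 0 (mem_chart_source H _)
    refine (h5.congr_of_eventuallyEq (key.mono fun t ht => (hval t ht).symm)).congr_deriv ?_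
    have e1 : (trivializationAt E (TangentSpace I : M → Type _) (c 0) (⟨c 0, v 0⟩ : TangentBundle I M)).2 = v 0 := by
      rw [TangentBundle.trivializationAt_apply]
      exact tangentCoordChange_self (I := I) (mem_extChartAt_source (c 0))
    have e2 : (trivializationAt (E →L[ℝ] ℝ) (fun x : M => CotangentSpace I x) (c 0) (⟨c 0, p 0⟩ : CotangentBundle I M)).2 = (p 0 : E →L[ℝ] ℝ) := by
      rw [hom_trivializationAt_apply]
      rw [ContinuousLinearMap.inCoordinates_eq (FiberBundle.mem_baseSet_trivializationAt' _) (by simp)]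
      ext w
      change (p 0) (((trivializationAt E (TangentSpace I : M → Type _) (c 0)).continuousLinearEquivAt ℝ (c 0) _).symm w) = p 0 w
      congr 1
      refine (ContinuousLinearEquiv.symm_apply_eq _).2 ?_
      change w = (trivializationAt E (TangentSpace I : M → Type _) (c 0) (⟨c 0, w⟩ : TangentBundle I M)).2
      rw [TangentBundle.trivializationAt_apply]
      exact (tangentCoordChange_self (I := I) (mem_extChartAt_source (c 0))).symm
    erw [e1, e2]
    rfl

/-! ### The cotangent lift of a discretization map -/

/-- The cotangent lift `R^{T^*} = Φ⁻¹ ∘ R̂ ∘ α_M : TT^*M → T^*M × T^*M`, defined at the vectors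
`V` for which `α_M V` lies over a point of the domain of `R` at which `R` is a local
diffeomorphism. -/
def PartialMap.cotangentLift (R : PartialMap I M) :
    PartialMap (cotangentModel I) (CotangentBundle I M) where
  dom := {V | (tulczyjew V).proj ∈ R.dom ∧
    (mfderiv I.tangent (I.prod I) R.toFun (tulczyjew V).proj).IsInvertible}
  toFun V := (Phi I M).symm (hatLift I.tangent (I.prod I) R.toFun (tulczyjew V))

end Defs

end DiscretizationMaps

end

open scoped Manifold ContDiff
open Bundle

noncomputable section

namespace DiscretizationMaps

variable {E : Type*} [NormedAddCommGroup E] [NormedSpace ℝ E]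
  {H : Type*} [TopologicalSpace H] {I : ModelWithCorners ℝ E H}
  {M : Type*} [TopologicalSpace M] [ChartedSpace H M]

variable (E) in
/-- The reflection `(u, v) ↦ (u, -v)` of `E × E`. -/
def reflEquiv : (E × E) ≃L[ℝ] (E × E) :=
  (ContinuousLinearEquiv.refl ℝ E).prodCongr (ContinuousLinearEquiv.neg ℝ)

@[simp] lemma reflEquiv_apply (u : E × E) : reflEquiv E u = (u.1, -u.2) := rfl

@[simp] lemma reflEquiv_symm_apply (u : E × E) : (reflEquiv E).symm u = (u.1, -u.2) := rfl

namespace PartialMap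

lemma Same.symm {R S : PartialMap I M} (h : R.Same S) : S.Same R :=
  ⟨h.1.symm, h.1 ▸ h.2.symm⟩

lemma Same.trans {R S T : PartialMap I M} (h : R.Same S) (h' : S.Same T) : R.Same T :=
  ⟨h.1.trans h'.1, h.2.trans (h.1 ▸ h'.2)⟩

end PartialMap

/-- Invertibility is preserved by a swap of the target and a reflection of the source. -/
lemma isInvertible_adjoint_iff (D : E × E →L[ℝ] E × E) :
    ((ContinuousLinearEquiv.prodComm ℝ E E : E × E →L[ℝ] E × E).comp
        (D.comp (reflEquiv E : E × E →L[ℝ] E × E))).IsInvertible ↔ D.IsInvertible := by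
  simp

/-- The linear algebra behind the compatibility of cotangent lifts and adjoints. -/
lemma comp_inverse_adjoint (D : E × E →L[ℝ] E × E) (a b : E →L[ℝ] ℝ) :
    (a.coprod b).comp ((ContinuousLinearEquiv.prodComm ℝ E E : E × E →L[ℝ] E × E).comp
        (D.comp (reflEquiv E : E × E →L[ℝ] E × E))).inverse =
      -((((-a).coprod b).comp D.inverse).comp
        (ContinuousLinearEquiv.prodComm ℝ E E : E × E →L[ℝ] E × E)) := by
  rw [ContinuousLinearMap.inverse_equiv_comp, ContinuousLinearMap.inverse_comp_equiv]
  ext u <;> simp <;> ring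

section Derivatives

variable [IsManifold I 1 M]

lemma trivializationAt_fiberNeg (x : M) {w : TangentBundle I M}
    (hw : w.proj ∈ (chartAt H x).source) :
    (trivializationAt E (TangentSpace I : M → Type _) x (fiberNeg w)).2 =
      -(trivializationAt E (TangentSpace I : M → Type _) x w).2 := by
  have hw' : w.proj ∈ (trivializationAt E (TangentSpace I : M → Type _) x).baseSet := by
    simpa using hw
  exact map_neg ((trivializationAt E (TangentSpace I : M → Type _) x).continuousLinearEquivAt ℝ
    w.proj hw') w.snd

lemma continuous_fiberNeg : Continuous (fiberNeg : TangentBundle I M → TangentBundle I M) := by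
  have hπ : Continuous (fun w : TangentBundle I M => w.proj) :=
    FiberBundle.continuous_proj E (TangentSpace I : M → Type _)
  refine continuous_iff_continuousAt.2 fun w => ?_
  refine (FiberBundle.continuousAt_totalSpace E (E := (TangentSpace I : M → Type _)) _).2
    ⟨hπ.continuousAt, ?_⟩
  have h := ((FiberBundle.continuousAt_totalSpace E (E := (TangentSpace I : M → Type _)) _).1
    (continuousAt_id (x := w))).2.neg
  refine h.congr ?_
  filter_upwards [hπ.continuousAt.eventually
    ((chartAt H w.proj).open_source.mem_nhds (mem_chart_source H _))] with z hz
  exact (trivializationAt_fiberNeg w.proj hz).symm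

/-- The derivative of the fibrewise reflection is `(u, v) ↦ (u, -v)`. -/
lemma hasMFDerivAt_fiberNeg (w : TangentBundle I M) :
    HasMFDerivAt I.tangent I.tangent (fiberNeg : TangentBundle I M → TangentBundle I M) w
      (reflEquiv E : E × E →L[ℝ] E × E) := by
  refine ⟨continuous_fiberNeg.continuousAt, ?_⟩
  have h : HasFDerivWithinAt (reflEquiv E) (reflEquiv E : E × E →L[ℝ] E × E)
    (Set.range I.tangent) (extChartAt I.tangent w w) := (reflEquiv E).hasFDerivWithinAt
  suffices hev : writtenInExtChartAt I.tangent I.tangent w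
      (fiberNeg : TangentBundle I M → TangentBundle I M)
      =ᶠ[nhdsWithin (extChartAt I.tangent w w) (Set.range I.tangent)] reflEquiv E from
    h.congr_of_eventuallyEq hev (hev.self_of_nhdsWithin (by exact ⟨_, rfl⟩))
  filter_upwards [extChartAt_target_mem_nhdsWithin (I := I.tangent) w] with z hz
  have hs := (extChartAt I.tangent w).map_target hz
  have hr := (extChartAt I.tangent w).right_inv hz
  set y := (extChartAt I.tangent w).symm z with hy
  have hb : y.proj ∈ (chartAt H w.proj).source := by
    rw [extChartAt_source] at hs
    simpa [TangentBundle.mem_chart_source_iff] using hs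
  have hc : ∀ w' y' : TangentBundle I M, y'.proj ∈ (chartAt H w'.proj).source →
      extChartAt I.tangent w' y' = (extChartAt I w'.proj y'.proj,
        (trivializationAt E (TangentSpace I : M → Type _) w'.proj y').2) := by
    intro w' y' h
    have : y' ∈ (trivializationAt E (TangentSpace I : M → Type _) w'.proj).source := by
      simpa [Trivialization.mem_source] using h
    rw [FiberBundle.extChartAt]
    simp [Trivialization.coe_fst _ this]
  change extChartAt I.tangent (fiberNeg w) (fiberNeg y) = reflEquiv E z
  rw [← hr, hc w y hb, hc (fiberNeg w) (fiberNeg y) hb]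
  exact Prod.ext rfl (trivializationAt_fiberNeg w.proj hb)

end Derivatives

variable [IsManifold I ∞ M]

/-- The tangent map of `F : TM → M × M` at `w`, as an endomorphism of the model space `E × E`. -/
def modelDeriv (F : TangentBundle I M → M × M) (w : TangentBundle I M) : E × E →L[ℝ] E × E :=
  mfderiv I.tangent (I.prod I) F w

namespace PartialMap

lemma IsDiscretizationMap.mdifferentiableAt {R : PartialMap I M} (hR : R.IsDiscretizationMap)
    {w : TangentBundle I M} (hw : w ∈ R.dom) :
    MDifferentiableAt I.tangent (I.prod I) R.toFun w :=
  (hR.smooth.contMDiffAt (hR.isOpen_dom.mem_nhds hw)).mdifferentiableAt (by simp)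

/-- The derivative of the adjoint at a point whose reflection lies in the domain. -/
lemma IsDiscretizationMap.mfderiv_adjoint {R : PartialMap I M} (hR : R.IsDiscretizationMap)
    {w : TangentBundle I M} (hw : fiberNeg w ∈ R.dom) :
    modelDeriv R.adjoint.toFun w =
      (ContinuousLinearEquiv.prodComm ℝ E E : E × E →L[ℝ] E × E).comp
        ((modelDeriv R.toFun (fiberNeg w)).comp
          (reflEquiv E : E × E →L[ℝ] E × E)) := by
  have : IsManifold I 1 M := IsManifold.of_le (n := ∞) (by simp)
  have h1 := (hR.mdifferentiableAt hw).hasMFDerivAt.comp w (hasMFDerivAt_fiberNeg w)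
  have h2 := (hasMFDerivAt_snd (I := I) (I' := I) (R.toFun (fiberNeg w))).prodMk
    (hasMFDerivAt_fst (I := I) (I' := I) (R.toFun (fiberNeg w)))
  exact (h2.comp w h1).mfderiv

/-- The cotangent lift depends on the values of the map on its domain only. -/
lemma Same.cotangentLift {R S : PartialMap I M} (hS : R.Same S) (hR : IsOpen R.dom) :
    R.cotangentLift.Same S.cotangentLift := by
  obtain ⟨hd, hv⟩ := hS
  have key : ∀ w ∈ R.dom, modelDeriv R.toFun w = modelDeriv S.toFun w := fun w hw =>
    Filter.EventuallyEq.mfderiv_eq (Filter.eventuallyEq_of_mem (hR.mem_nhds hw) hv)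
  refine ⟨Set.ext fun V => ?_, fun V hV => ?_⟩
  · change (_ ∈ R.dom ∧ ContinuousLinearMap.IsInvertible
      (modelDeriv R.toFun (tulczyjew V).proj)) ↔
      (_ ∈ S.dom ∧ _)
    rw [← hd]
    refine and_congr_right fun hw => ?_
    rw [key _ hw]
    rfl
  · have hw : (tulczyjew V).proj ∈ R.dom := hV.1
    change (Phi I M).symm ⟨R.toFun _, ContinuousLinearMap.comp _ (ContinuousLinearMap.inverse
      (modelDeriv R.toFun (tulczyjew V).proj))⟩ =
      (Phi I M).symm ⟨S.toFun _, _⟩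
    rw [key _ hw, hv hw]
    rfl

/-- Taking the cotangent lift commutes with taking the adjoint. -/
theorem IsDiscretizationMap.cotangentLift_adjoint {R : PartialMap I M}
    (hR : R.IsDiscretizationMap) : R.adjoint.cotangentLift.Same R.cotangentLift.adjoint := by
  refine ⟨Set.ext fun V => ?_, fun V hV => ?_⟩
  · change (fiberNeg (tulczyjew V).proj ∈ R.dom ∧ ContinuousLinearMap.IsInvertible
      (modelDeriv R.adjoint.toFun (tulczyjew V).proj)) ↔
      (fiberNeg (tulczyjew V).proj ∈ R.dom ∧ ContinuousLinearMap.IsInvertible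
      (modelDeriv R.toFun (fiberNeg (tulczyjew V).proj)))
    refine and_congr_right fun hw => ?_
    rw [hR.mfderiv_adjoint hw, isInvertible_adjoint_iff]
  · have hw : fiberNeg (tulczyjew V).proj ∈ R.dom := hV.1
    have h := comp_inverse_adjoint
      (modelDeriv R.toFun (fiberNeg (tulczyjew V).proj))
      (V.snd : E × (E →L[ℝ] ℝ)).2 V.proj.snd
    rw [← hR.mfderiv_adjoint hw] at h
    refine Prod.ext (congrArg (TotalSpace.mk _) ?_) (congrArg (TotalSpace.mk _) ?_)
    · refine (congrArg (fun β : E × E →L[ℝ] ℝ => -(β.comp (ContinuousLinearMap.inl ℝ E E))) h).trans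
        ?_
      refine ContinuousLinearMap.ext fun u => ?_
      exact neg_neg _
    · exact congrArg (fun β : E × E →L[ℝ] ℝ => β.comp (ContinuousLinearMap.inr ℝ E E)) h

end PartialMap

end DiscretizationMaps

end

theorem mainTheorem8 {E : Type*} [NormedAddCommGroup E] [NormedSpace ℝ E] [FiniteDimensional ℝ E]
    {H : Type*} [TopologicalSpace H] (I : ModelWithCorners ℝ E H) [I.Boundaryless]
    (Q : Type*) [TopologicalSpace Q] [ChartedSpace H Q] [IsManifold I ∞ Q]
    (R : DiscretizationMaps.PartialMap I Q) (hR : R.IsDiscretizationMap) :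
    R.adjoint.cotangentLift.Same R.cotangentLift.adjoint ∧
      (R.IsSymmetric → R.cotangentLift.IsSymmetric) := by
  refine ⟨hR.cotangentLift_adjoint, fun hs => ?_⟩
  have hopen : IsOpen R.adjoint.dom := by rw [hs.1]; exact hR.isOpen_dom
  exact hR.cotangentLift_adjoint.symm.trans (hs.cotangentLift hopen)
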